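/- Let $q$ be a prime, let $\ell$ be a positive integer, and let $G$ be an invertible $\ell\times\ell$ matrix over the prime field $\mathbb F_q$ whose lower triangular form is not diagonal; that is, $G=VLP$ with $V$ upper triangular, $L$ lower triangular and not diagonal, and $P$ a permutation matrix. (In particular, $G$ may be any invertible lower triangular matrix that is not diagonal.) A channel $W:\mathbb F_q\to\mathcal Y$ consists of an at most countable set $\mathcal Y$ and a probability distribution $W(\cdot\mid x)$ on $\mathcal Y$ for each $x\in\mathbb F_q$. Its symmetric capacity is $$I(W)=\sum_{x\in\mathbb F_q}\sum_{y\in\mathcal Y}\frac1q W(y\mid x)\log_q\frac{W(y\mid x)}{\frac1q\sum_{x'\in\mathbb F_q}W(y\mid x')}.$$ For $i\in\{0,\dots,\ell-1\}$ the subchannel $W^{(i)}:\mathbb F_q\to\mathcal Y^{\ell}\times\mathbb F_q^{\,i}$ is $$W^{(i)}(y_0^{\ell-1},u_0^{i-1}\mid u_i)=\frac1{q^{\ell-1}}\sum_{u_{i+1}^{\ell-1}}\ \prod_{j=0}^{\ell-1}W\bigl(y_j\mid (u_0^{\ell-1}G)_j\bigr),$$ where $u_0^{\ell-1}=(u_0,\dots,u_{\ell-1})$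 is a row vector. Let $B_1,B_2,\dots$ be independent random variables, uniform on $\{0,\dots,\ell-1\}$. Then for every channel $W:\mathbb F_q\to\mathcal Y$ the sequence $I_n=I(W^{(B_1)\cdots(B_n)})$, $n\ge 0$, where $W^{(b_1)\cdots(b_n)}=(\cdots(W^{(b_1)})^{(b_2)}\cdots)^{(b_n)}$, is a martingale with respect to the filtration $\sigma(B_1,\dots,B_n)$, and it converges almost surely to a random variable $I_\infty$ with $P(I_\infty\in\{0,1\})=1$. -/

import Mathlib

open MeasureTheory ProbabilityTheory Filter Topology

universe u

noncomputable section

/-- A discrete memoryless channel `W : X → Y` with finite input alphabet `X` and an (at most)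
countable output alphabet `Y = Out`; `prob x y` is the transition probability `W(y ∣ x)`. -/
structure DMC (X : Type) where
  Out : Type u
  countable_out : Countable Out
  prob : X → Out → ℝ
  prob_nonneg : ∀ x y, 0 ≤ prob x y
  hasSum_prob : ∀ x, HasSum (prob x) 1

namespace DMC

variable {X : Type} {ℓ : ℕ}

/-- The symmetric capacity `I(W)`, with logarithms to the base `q = |X|`; the terms with
`W(y ∣ x) = 0` are zero. -/
def symmetricCapacity [Fintype X] (W : DMC.{u} X) : ℝ :=
  ∑ x : X, ∑' y : W.Out,
    1 / (Fintype.card X : ℝ) * W.prob x y *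
      Real.logb (Fintype.card X)
        (W.prob x y / (1 / (Fintype.card X : ℝ) * ∑ x' : X, W.prob x' y))

/-- `W^ℓ(y ∣ x)`: the transition probability of `ℓ` independent uses of `W`. -/
def blockProb (W : DMC.{u} X) (x : Fin ℓ → X) (y : Fin ℓ → W.Out) : ℝ :=
  ∏ j, W.prob (x j) (y j)

lemma hasSum_blockProb (W : DMC.{u} X) (x : Fin ℓ → X) : HasSum (W.blockProb x) 1 := by
  induction ℓ with
  | zero =>
    have h := hasSum_unique (W.blockProb x)
    simpa [blockProb] using h
  | succ n ih =>
    have h1 := W.hasSum_prob (x 0)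
    have h2 := ih (fun j => x j.succ)
    have h3 := h1.mul h2 (h1.summable.mul_of_nonneg h2.summable (W.prob_nonneg _)
      (fun y => Finset.prod_nonneg fun j _ => W.prob_nonneg _ _))
    rw [← (Fin.consEquiv fun _ => W.Out).hasSum_iff]
    rw [one_mul] at h3
    have h4 : W.blockProb x ∘ (Fin.consEquiv fun _ => W.Out) = _ := funext fun p => by
      rw [Function.comp_apply, blockProb, Fin.prod_univ_succ]
    rw [h4]
    exact h3

variable [Fintype X] [DecidableEq X]

/-- `W⁽ⁱ⁾(y_0^{ℓ-1}, u_0^{i-1} ∣ u_i)` for the kernel `g`: the sum of `W^ℓ(y ∣ g(u))` over all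
completions `u` of the given `u_0^{i-1}` and `u_i`, divided by `q^(ℓ-1)`. -/
def subchannelProb (W : DMC.{u} X) (g : (Fin ℓ → X) → (Fin ℓ → X)) (i : Fin ℓ) (x : X)
    (o : (Fin ℓ → W.Out) × (Set.Iio i → X)) : ℝ :=
  1 / (Fintype.card X : ℝ) ^ (ℓ - 1) *
    ∑ u : Fin ℓ → X with (∀ j : Set.Iio i, u j = o.2 j) ∧ u i = x, W.blockProb (g u) o.1

lemma subchannelProb_nonneg (W : DMC.{u} X) (g : (Fin ℓ → X) → (Fin ℓ → X)) (i : Fin ℓ) (x : X)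
    (o : (Fin ℓ → W.Out) × (Set.Iio i → X)) : 0 ≤ W.subchannelProb g i x o :=
  mul_nonneg (by positivity)
    (Finset.sum_nonneg fun _ _ => Finset.prod_nonneg fun _ _ => W.prob_nonneg _ _)

lemma card_filter_apply_eq (i : Fin ℓ) (x : X) :
    (Finset.univ.filter fun u : Fin ℓ → X => u i = x).card = Fintype.card X ^ (ℓ - 1) := by
  obtain ⟨n, rfl⟩ : ∃ n, ℓ = n + 1 := ⟨ℓ - 1, by have := i.pos; omega⟩
  have h : (Finset.univ.filter fun u : Fin (n + 1) → X => u i = x).card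
      = (Finset.univ : Finset (Fin n → X)).card := by
    refine Finset.card_nbij' (fun u => i.removeNth u) (fun v => i.insertNth (α := fun _ => X) x v)
      ?_ ?_ ?_ ?_
    · intro u _
      simp
    · intro v _
      simp
    · intro u hu
      have hu' : u i = x := by simpa using hu
      simp [← hu']
    · intro v _
      simp
  rw [h]
  simp

lemma hasSum_subchannelProb (W : DMC.{u} X) (g : (Fin ℓ → X) → (Fin ℓ → X)) (i : Fin ℓ) (x : X) :
    HasSum (W.subchannelProb g i x) 1 := by
  have hq : ((Fintype.card X : ℝ) ^ (ℓ - 1)) ≠ 0 := by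
    have : Nonempty X := ⟨x⟩
    positivity
  -- the contribution of one full input vector
  have key : ∀ u : Fin ℓ → X,
      HasSum (fun o : (Fin ℓ → W.Out) × (Set.Iio i → X) =>
        if (∀ j : Set.Iio i, u j = o.2 j) ∧ u i = x then W.blockProb (g u) o.1 else 0)
        (if u i = x then 1 else 0) := by
    intro u
    by_cases hx : u i = x
    · simp only [hx, and_true, if_true]
      have hinj : Function.Injective
          (fun y : Fin ℓ → W.Out => (y, fun j : Set.Iio i => u j)) :=
        fun a b h => (Prod.ext_iff.1 h).1
      rw [← hinj.hasSum_iff]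
      · convert W.hasSum_blockProb (g u) using 1
        funext y
        simp
      · rintro ⟨y, v⟩ ho
        refine if_neg fun hv => ho ⟨y, ?_⟩
        exact Prod.ext rfl (funext fun j => hv j)
    · simp [hx, hasSum_zero]
  have h := (hasSum_sum fun u (_ : u ∈ Finset.univ) => key u).mul_left
    (1 / (Fintype.card X : ℝ) ^ (ℓ - 1))
  have h1 : (1 / (Fintype.card X : ℝ) ^ (ℓ - 1)) *
      ∑ u : Fin ℓ → X, (if u i = x then (1 : ℝ) else 0) = 1 := by
    rw [Finset.sum_boole, card_filter_apply_eq]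
    push_cast
    field_simp
  rw [h1] at h
  have h2 : W.subchannelProb g i x = _ := funext fun o => by
    rw [subchannelProb, Finset.sum_filter]
  rw [h2]
  exact h

/-- The subchannel `W⁽ⁱ⁾ : X → Y^ℓ × X^i` of `W` for the kernel `g`. -/
def subchannel (W : DMC.{u} X) (g : (Fin ℓ → X) → (Fin ℓ → X)) (i : Fin ℓ) : DMC.{u} X where
  Out := (Fin ℓ → W.Out) × (Set.Iio i → X)
  countable_out := by
    have := W.countable_out
    infer_instance
  prob := W.subchannelProb g i
  prob_nonneg := W.subchannelProb_nonneg g i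
  hasSum_prob := W.hasSum_subchannelProb g i

/-- The iterated subchannel `W^{(b_0)(b_1)⋯(b_{n-1})}`. -/
def iterSubchannel (W : DMC.{u} X) (g : (Fin ℓ → X) → (Fin ℓ → X)) (b : ℕ → Fin ℓ) :
    ℕ → DMC.{u} X
  | 0 => W
  | n + 1 => (iterSubchannel W g b n).subchannel g (b n)

end DMC

/-- The filtration `𝓕_n = σ(B_0, …, B_{n-1})`. -/
def pastFiltration {Ω : Type*} [mΩ : MeasurableSpace Ω] {ℓ : ℕ} (B : ℕ → Ω → Fin ℓ)
    (hB : ∀ n, Measurable (B n)) : Filtration ℕ mΩ where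
  seq n := ⨆ j ∈ Set.Iio n, MeasurableSpace.comap (B j) inferInstance
  mono' _ _ hmn := biSup_mono fun _ hj => lt_of_lt_of_le hj hmn
  le' _ := iSup₂_le fun j _ => (hB j).comap_le

end

/-!
Write `H(W)` for the conditional entropy of a uniform input given the output, so that
`I(W) = 1 - H(W) / log q`.

The martingale property is the chain rule: since `u ↦ uG` is a bijection, revealing
`u₀, …, u_{ℓ-1}` one after the other shows that the entropies `H(W⁽ⁱ⁾)` add up to `ℓ * H(W)`
(`DMC.sum_condEntropy_subchannel`), and `Bₙ` is uniform given the past. The process takes values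
in `[0, 1]`, so it converges almost surely.

That the limit is `0` or `1` rests on one subchannel whose capacity exceeds that of `W` by a
definite amount (`DMC.exists_gain`): for each `δ > 0` there is `ε > 0` such that
`I(W⁽ᵏ⁾) ≥ I(W) + ε` for *every* channel with `δ ≤ I(W) ≤ 1 - δ`. The output alphabets of the
iterated subchannels grow without bound, so it matters that `ε` depends only on `δ` and `q`. By the
second Borel–Cantelli lemma `Bₙ = k` infinitely often, and a convergent sequence cannot jump by `ε`
infinitely often.

Here `k` is the last row of `L` with an entry off the diagonal. Given the past, two coordinates
of the codeword are `z` and `γ * z + c`, where `z` is an affine bijective image of `u k`, `γ ≠ 0`,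
and `c` is known and uniform (`exists_column_pair`, `vecMul_column_pair`). Hence the subchannel
`k` is at least as good as two looks at `z`, one of them randomly shifted
(`DMC.condEntropy_subchannel_le_twoLook`).
For any two inputs `z ≠ z'`, the entropy gained from the second look is at least half the product
of

* the overlap of the output distributions of `z` and `z'`, and
* the squared Hellinger distance between the outputs at `γ * z + c` and `γ * z' + c`, summed
  over `c`

(`DMC.tsum_massEntropy_twoLookProb_add_le`, which comes from the strengthened Gibbs inequality
`massEntropy_mul_add_le`). If `H(W)` is not small, then some two inputs have a large overlap
(`DMC.condEntropy_le_add_sum_overlap`). If `I(W)` is not small, then the second factor is large for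
every pair `z ≠ z'` (`DMC.log_sub_condEntropy_le_shiftDist`). The latter uses that `q` is prime:
the multiples of the step `γ * (z' - z)` exhaust the field, so if this step were hardly
noticeable, all inputs would look alike.
-/

/-! ### The entropy of an unnormalized mass function -/

/-- The entropy functional `∑ₐ v a * log ((∑ v) / v a)` of a nonnegative mass function on a finite
type, in nats. For a probability vector it is the Shannon entropy; in general it is the total mass
times the entropy of the normalized vector, hence homogeneous of degree one. -/
noncomputable def massEntropy {α : Type*} [Fintype α] (v : α → ℝ) : ℝ :=
  ∑ a, Real.negMulLog (v a) - Real.negMulLog (∑ a, v a)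

section MassEntropy

variable {α : Type*} [Fintype α]

lemma massEntropy_eq_sum {v : α → ℝ} (hv : ∀ a, 0 ≤ v a) :
    massEntropy v = ∑ a, v a * Real.log ((∑ b, v b) / v a) := by
  have h : ∀ a, v a * Real.log ((∑ b, v b) / v a)
      = Real.negMulLog (v a) + v a * Real.log (∑ b, v b) := by
    intro a
    rcases (hv a).eq_or_lt with h0 | h0
    · simp [← h0]
    · have hs : 0 < ∑ b, v b :=
        h0.trans_le (Finset.single_le_sum (fun b _ => hv b) (Finset.mem_univ a))
      rw [Real.log_div hs.ne' h0.ne', Real.negMulLog]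
      ring
  rw [Finset.sum_congr rfl fun a _ => h a, Finset.sum_add_distrib, ← Finset.sum_mul,
    massEntropy, Real.negMulLog]
  ring

lemma mul_log_sum_div_nonneg {v : α → ℝ} (hv : ∀ a, 0 ≤ v a) (a : α) :
    0 ≤ v a * Real.log ((∑ b, v b) / v a) := by
  rcases (hv a).eq_or_lt with h0 | h0
  · simp [← h0]
  · refine mul_nonneg (hv a) (Real.log_nonneg ?_)
    rw [le_div_iff₀ h0, one_mul]
    exact Finset.single_le_sum (fun b _ => hv b) (Finset.mem_univ a)

lemma massEntropy_nonneg {v : α → ℝ} (hv : ∀ a, 0 ≤ v a) : 0 ≤ massEntropy v := by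
  rw [massEntropy_eq_sum hv]
  exact Finset.sum_nonneg fun a _ => mul_log_sum_div_nonneg hv a

lemma massEntropy_comp_equiv {β : Type*} [Fintype β] (v : α → ℝ) (e : β ≃ α) :
    massEntropy (fun b => v (e b)) = massEntropy v := by
  unfold massEntropy
  rw [Equiv.sum_comp e v, Equiv.sum_comp e fun a => Real.negMulLog (v a)]

/-- One term of the relative entropy dominates the squared Hellinger distance. -/
lemma mul_log_div_le_sub_sq_sqrt {w r : ℝ} (hw : 0 < w) (hr : 0 < r) :
    w * Real.log (r / w) ≤ r - w - (√w - √r) ^ 2 := by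
  have h1 : Real.log (r / w) ≤ 2 * (√r / √w - 1) := by
    have h2 : r / w = (√r / √w) ^ 2 := by
      rw [div_pow, Real.sq_sqrt hr.le, Real.sq_sqrt hw.le]
    rw [h2, Real.log_pow]
    have := Real.log_le_sub_one_of_pos (div_pos (Real.sqrt_pos.2 hr) (Real.sqrt_pos.2 hw))
    push_cast
    linarith
  have h3 : w * (√r / √w) = √w * √r := by
    have h4 := Real.sqrt_pos.2 hw
    nth_rewrite 1 [← Real.sq_sqrt hw.le]
    field_simp
  nlinarith [mul_le_mul_of_nonneg_left h1 hw.le, Real.sq_sqrt hr.le, Real.sq_sqrt hw.le]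

/-- A strengthened Gibbs inequality. With `m` an unnormalized prior and `w` the likelihoods of one
observation, the right-hand side is the contribution of the observation to the prior entropy and
`massEntropy (m * w)` its contribution to the posterior entropy. The gap is at least the Hellinger
discrepancy of any two likelihoods, weighted by the smaller of the two prior masses. -/
lemma massEntropy_mul_add_le {m w : α → ℝ} (hm : ∀ a, 0 ≤ m a) (hw : ∀ a, 0 ≤ w a) (z z' : α) :
    massEntropy (fun a => m a * w a) + 1 / 2 * min (m z) (m z') * (√(w z) - √(w z')) ^ 2
      ≤ ∑ a, w a * (m a * Real.log ((∑ b, m b) / m a)) := by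
  set M := ∑ b, m b with hM
  have hM0 : 0 ≤ M := Finset.sum_nonneg fun b _ => hm b
  rcases hM0.eq_or_lt with h0 | h0
  · have hz : ∀ a, m a = 0 := fun a =>
      (Finset.sum_eq_zero_iff_of_nonneg fun b _ => hm b).1 (hM.symm.trans h0.symm) a
        (Finset.mem_univ a)
    simp [hz, massEntropy]
  -- `r` is the mean likelihood
  set r := (∑ b, m b * w b) / M with hr
  have hrM : ∑ b, m b * w b = M * r := by rw [hr]; field_simp
  have hr0 : 0 ≤ r := div_nonneg (Finset.sum_nonneg fun b _ => mul_nonneg (hm b) (hw b)) h0.le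
  have term : ∀ a, m a * w a * Real.log (M * r / (m a * w a)) + m a * (√(w a) - √r) ^ 2
      ≤ w a * (m a * Real.log (M / m a)) + m a * (r - w a) := by
    intro a
    rcases (hm a).eq_or_lt with hma | hma
    · simp [← hma]
    rcases (hw a).eq_or_lt with hwa | hwa
    · simp [← hwa, Real.sq_sqrt hr0]
    have hr1 : 0 < r := by
      have : 0 < M * r := by
        rw [← hrM]
        exact (mul_pos hma hwa).trans_le
          (Finset.single_le_sum (f := fun b => m b * w b)
            (fun b _ => mul_nonneg (hm b) (hw b)) (Finset.mem_univ a))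
      exact pos_of_mul_pos_right this h0.le
    have h1 : Real.log (M * r / (m a * w a)) = Real.log (M / m a) + Real.log (r / w a) := by
      rw [← Real.log_mul (by positivity) (by positivity)]
      congr 1
      field_simp
    rw [h1]
    nlinarith [mul_le_mul_of_nonneg_left (mul_log_div_le_sub_sq_sqrt hwa hr1) hma.le]
  have hsum := Finset.sum_le_sum fun a (_ : a ∈ Finset.univ) => term a
  have hzero : ∑ a, m a * (r - w a) = 0 := by
    simp only [mul_sub, Finset.sum_sub_distrib, ← Finset.sum_mul, hrM]
    rw [← hM]
    ring
  rw [Finset.sum_add_distrib, Finset.sum_add_distrib, hzero, add_zero, ← hrM,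
    ← massEntropy_eq_sum fun a => mul_nonneg (hm a) (hw a)] at hsum
  refine le_trans (add_le_add_right ?_ _) hsum
  have hnn : ∀ a, 0 ≤ m a * (√(w a) - √r) ^ 2 := fun a => mul_nonneg (hm a) (sq_nonneg _)
  by_cases hzz : z = z'
  · subst hzz
    simpa using Finset.sum_nonneg fun a _ => hnn a
  classical
  have hpair : m z * (√(w z) - √r) ^ 2 + m z' * (√(w z') - √r) ^ 2
      ≤ ∑ a, m a * (√(w a) - √r) ^ 2 := by
    rw [← Finset.sum_pair (f := fun a => m a * (√(w a) - √r) ^ 2) hzz]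
    exact Finset.sum_le_sum_of_subset_of_nonneg (Finset.subset_univ _) fun a _ _ => hnn a
  refine le_trans ?_ hpair
  have hmin : 0 ≤ min (m z) (m z') := le_min (hm z) (hm z')
  have h1 : min (m z) (m z') * (√(w z) - √r) ^ 2 ≤ m z * (√(w z) - √r) ^ 2 :=
    mul_le_mul_of_nonneg_right (min_le_left _ _) (sq_nonneg _)
  have h2 : min (m z) (m z') * (√(w z') - √r) ^ 2 ≤ m z' * (√(w z') - √r) ^ 2 :=
    mul_le_mul_of_nonneg_right (min_le_right _ _) (sq_nonneg _)
  have h3 : 1 / 2 * (√(w z) - √(w z')) ^ 2 ≤ (√(w z) - √r) ^ 2 + (√(w z') - √r) ^ 2 := by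
    nlinarith [sq_nonneg ((√(w z) - √r) + (√(w z') - √r))]
  nlinarith [mul_le_mul_of_nonneg_left h3 hmin]

/-- Gibbs' inequality, for a reference mass `m` dominating `v`. -/
lemma massEntropy_le_of_le {v m : α → ℝ} (hv : ∀ a, 0 ≤ v a) (hvm : ∀ a, v a ≤ m a) :
    massEntropy v ≤ ∑ a, v a * Real.log ((∑ b, m b) / m a) := by
  rcases isEmpty_or_nonempty α with hα | ⟨⟨z⟩⟩
  · simp [massEntropy]
  have hm : ∀ a, 0 ≤ m a := fun a => (hv a).trans (hvm a)
  have hmul : ∀ a, m a * (v a / m a) = v a := by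
    intro a
    rcases (hm a).eq_or_lt with h | h
    · simp [← h, le_antisymm ((hvm a).trans h.symm.le) (hv a)]
    · field_simp
  have h := massEntropy_mul_add_le hm (fun a => div_nonneg (hv a) (hm a)) z z
  simp only [hmul, sub_self, ne_eq, OfNat.ofNat_ne_zero, not_false_eq_true, zero_pow, mul_zero,
    add_zero] at h
  refine h.trans_eq (Finset.sum_congr rfl fun a _ => ?_)
  rw [← mul_assoc, mul_comm (v a / m a), hmul]

lemma massEntropy_add_le {v w : α → ℝ} (hv : ∀ a, 0 ≤ v a) (hw : ∀ a, 0 ≤ w a) :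
    massEntropy v + massEntropy w ≤ massEntropy (fun a => v a + w a) := by
  have h1 := massEntropy_le_of_le hv (m := fun a => v a + w a) fun a => by linarith [hw a]
  have h2 := massEntropy_le_of_le hw (m := fun a => v a + w a) fun a => by linarith [hv a]
  rw [massEntropy_eq_sum fun a => add_nonneg (hv a) (hw a)]
  simp only [add_mul, Finset.sum_add_distrib] at h1 h2 ⊢
  exact add_le_add h1 h2

lemma massEntropy_mono {v w : α → ℝ} (hv : ∀ a, 0 ≤ v a) (hvw : ∀ a, v a ≤ w a) :
    massEntropy v ≤ massEntropy w := by
  have h := massEntropy_add_le hv (w := fun a => w a - v a) fun a => sub_nonneg.2 (hvw a)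
  have h0 := massEntropy_nonneg (v := fun a => w a - v a) fun a => sub_nonneg.2 (hvw a)
  simp only [add_sub_cancel] at h
  exact (le_add_of_nonneg_right h0).trans h

lemma sum_massEntropy_le {ι : Type*} (s : Finset ι) {v : ι → α → ℝ} (hv : ∀ i a, 0 ≤ v i a) :
    ∑ i ∈ s, massEntropy (v i) ≤ massEntropy (fun a => ∑ i ∈ s, v i a) := by
  classical
  induction s using Finset.induction_on with
  | empty => simp [massEntropy]
  | insert i s hi ih =>
    simp only [Finset.sum_insert hi]
    exact (add_le_add_right ih _).trans
      (massEntropy_add_le (hv i) fun a => Finset.sum_nonneg fun j _ => hv j a)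

lemma massEntropy_le_log_card [Nonempty α] {v : α → ℝ} (hv : ∀ a, 0 ≤ v a) :
    massEntropy v ≤ Real.log (Fintype.card α) * ∑ a, v a := by
  obtain ⟨z⟩ := ‹Nonempty α›
  have h := massEntropy_mul_add_le (m := fun _ => 1) (fun _ => zero_le_one) hv z z
  simp only [one_mul, sub_self, ne_eq, OfNat.ofNat_ne_zero, not_false_eq_true, zero_pow, mul_zero,
    add_zero, Finset.sum_const, Finset.card_univ, nsmul_eq_mul, mul_one, div_one,
    ← Finset.sum_mul] at h
  rwa [mul_comm] at h

/-- The entropy is small unless two coordinates are simultaneously large. -/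
lemma massEntropy_le_add_sum_min [DecidableEq α] {v : α → ℝ} (hv : ∀ a, 0 ≤ v a) {K : ℝ}
    (hK : 1 ≤ K) :
    massEntropy v ≤ Fintype.card α / K * ∑ a, v a
      + K * ∑ a, ∑ b ∈ Finset.univ.erase a, min (v a) (v b) := by
  rw [massEntropy_eq_sum hv]
  set s := ∑ b, v b with hs
  have hs0 : 0 ≤ s := Finset.sum_nonneg fun b _ => hv b
  have key : ∀ a, v a * Real.log (s / v a)
      ≤ s / K + K * ∑ b ∈ Finset.univ.erase a, min (v a) (v b) := by
    intro a
    have hmin0 : ∀ b, 0 ≤ min (v a) (v b) := fun b => le_min (hv a) (hv b)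
    have hK0 : 0 < K := by linarith
    rcases (hv a).eq_or_lt with ha | ha
    · rw [← ha, zero_mul]
      exact add_nonneg (by positivity)
        (mul_nonneg hK0.le (Finset.sum_nonneg fun b _ => ha ▸ hmin0 b))
    have hsplit : v a + ∑ b ∈ Finset.univ.erase a, v b = s :=
      Finset.add_sum_erase _ _ (Finset.mem_univ a)
    have hsp : 0 < s := by
      have : 0 ≤ ∑ b ∈ Finset.univ.erase a, v b := Finset.sum_nonneg fun b _ => hv b
      linarith
    by_cases hb : ∃ b ∈ Finset.univ.erase a, v a ≤ v b
    · -- some other coordinate is at least `v a`, so the sum of minima is at least `v a`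
      obtain ⟨b, hbm, hb⟩ := hb
      have h1 : v a ≤ ∑ b ∈ Finset.univ.erase a, min (v a) (v b) :=
        (le_min le_rfl hb).trans
          (Finset.single_le_sum (f := fun b => min (v a) (v b)) (fun b _ => hmin0 b) hbm)
      have h2 : Real.log (s / v a) ≤ s / (v a * K) + K := by
        have h3 : s / v a = s / (v a * K) * K := by field_simp
        rw [h3, Real.log_mul (by positivity) (by positivity)]
        have h4 := Real.log_le_sub_one_of_pos (show 0 < s / (v a * K) by positivity)
        have h5 := Real.log_le_sub_one_of_pos hK0
        linarith
      calc v a * Real.log (s / v a) ≤ v a * (s / (v a * K) + K) :=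
            mul_le_mul_of_nonneg_left h2 ha.le
        _ = s / K + K * v a := by field_simp
        _ ≤ _ := by gcongr
    · -- all other coordinates are below `v a`, so the minima add up to the rest of the mass
      push Not at hb
      have h1 : ∑ b ∈ Finset.univ.erase a, min (v a) (v b)
          = ∑ b ∈ Finset.univ.erase a, v b :=
        Finset.sum_congr rfl fun b hbm => min_eq_right (hb b hbm).le
      have h2 := Real.log_le_sub_one_of_pos (show 0 < s / v a by positivity)
      have h3 : 0 ≤ ∑ b ∈ Finset.univ.erase a, v b := Finset.sum_nonneg fun b _ => hv b
      rw [h1]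
      calc v a * Real.log (s / v a) ≤ v a * (s / v a - 1) := mul_le_mul_of_nonneg_left h2 ha.le
        _ = s - v a := by field_simp
        _ = ∑ b ∈ Finset.univ.erase a, v b := by linarith
        _ ≤ K * ∑ b ∈ Finset.univ.erase a, v b := le_mul_of_one_le_left h3 hK
        _ ≤ _ := le_add_of_nonneg_left (by positivity)
  refine (Finset.sum_le_sum fun a _ => key a).trans_eq ?_
  rw [Finset.sum_add_distrib, ← Finset.mul_sum, Finset.sum_const, Finset.card_univ, nsmul_eq_mul]
  ring

/-- The entropy is nearly maximal if all coordinates are nearly equal. -/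
lemma log_card_mul_sub_massEntropy_le {v : α → ℝ} (hv : ∀ a, 0 ≤ v a) :
    Real.log (Fintype.card α) * ∑ a, v a - massEntropy v
      ≤ 2 * ∑ a, ∑ b, (√(v a) - √(v b)) ^ 2 := by
  rw [massEntropy_eq_sum hv]
  set s := ∑ b, v b with hs
  have hs0 : 0 ≤ s := Finset.sum_nonneg fun b _ => hv b
  rcases hs0.eq_or_lt with h0 | h0
  · have hz : ∀ a, v a = 0 := fun a =>
      (Finset.sum_eq_zero_iff_of_nonneg fun b _ => hv b).1 (hs.symm.trans h0.symm) a
        (Finset.mem_univ a)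
    simp [hz, ← h0]
  have hcard : 0 < (Fintype.card α : ℝ) := by
    rcases isEmpty_or_nonempty α with hα | hα
    · simp [hs] at h0
    · exact_mod_cast Fintype.card_pos
  set n := (Fintype.card α : ℝ) with hn
  have h1 : Real.log n * s - ∑ a, v a * Real.log (s / v a) ≤ ∑ a, v a * (n * v a / s - 1) := by
    rw [hs, Finset.mul_sum, ← hs, ← Finset.sum_sub_distrib]
    refine Finset.sum_le_sum fun a _ => ?_
    rcases (hv a).eq_or_lt with ha | ha
    · simp [← ha]
    have h2 : Real.log (n * v a / s) = Real.log n - Real.log (s / v a) := by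
      rw [← Real.log_div (by positivity) (by positivity)]
      congr 1
      field_simp
    have h3 := Real.log_le_sub_one_of_pos (show 0 < n * v a / s by positivity)
    nlinarith [mul_le_mul_of_nonneg_left (h2 ▸ h3) ha.le]
  have h2 : ∑ a, v a * (n * v a / s - 1) = (2 * s)⁻¹ * ∑ a, ∑ b, (v a - v b) ^ 2 := by
    have h3 : ∑ a, ∑ b, (v a - v b) ^ 2 = 2 * n * ∑ a, v a ^ 2 - 2 * s ^ 2 := by
      simp only [sub_sq, Finset.sum_add_distrib, Finset.sum_sub_distrib, Finset.sum_const,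
        Finset.card_univ, nsmul_eq_mul, ← Finset.mul_sum, mul_assoc, ← Finset.sum_mul]
      rw [← hs, ← hn]
      ring
    have h4 : ∑ a, v a * (n * v a / s - 1) = n / s * ∑ a, v a ^ 2 - s := by
      rw [hs, Finset.mul_sum, ← Finset.sum_sub_distrib]
      exact Finset.sum_congr rfl fun a _ => by ring
    rw [h3, h4]
    field_simp
  refine h1.trans (h2.trans_le ?_)
  rw [inv_mul_le_iff₀ (by positivity)]
  simp_rw [Finset.mul_sum]
  refine Finset.sum_le_sum fun a _ => Finset.sum_le_sum fun b _ => ?_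
  have ha : v a ≤ s := Finset.single_le_sum (fun b _ => hv b) (Finset.mem_univ a)
  have hb : v b ≤ s := Finset.single_le_sum (fun b _ => hv b) (Finset.mem_univ b)
  have h5 : (v a - v b) ^ 2 = (√(v a) - √(v b)) ^ 2 * (√(v a) + √(v b)) ^ 2 := by
    rw [← mul_pow, ← Real.sq_sqrt (hv a), ← Real.sq_sqrt (hv b)]
    simp only [Real.sqrt_sq (Real.sqrt_nonneg _)]
    ring
  have h6 : (√(v a) + √(v b)) ^ 2 ≤ 4 * s := by
    nlinarith [sq_nonneg (√(v a) - √(v b)), Real.sq_sqrt (hv a), Real.sq_sqrt (hv b)]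
  rw [h5]
  nlinarith [mul_le_mul_of_nonneg_left h6 (sq_nonneg (√(v a) - √(v b)))]

end MassEntropy

/-! ### Sums and entropies of product functions -/

section Product

lemma hasSum_mul_of_nonneg {β γ : Type*} {f : β → ℝ} {g : γ → ℝ} {a b : ℝ} (hf : ∀ x, 0 ≤ f x)
    (hg : ∀ y, 0 ≤ g y) (h1 : HasSum f a) (h2 : HasSum g b) :
    HasSum (fun p : β × γ => f p.1 * g p.2) (a * b) :=
  h1.mul h2 (h1.summable.mul_of_nonneg h2.summable hf hg)

variable {ℓ : ℕ}

/-- The sum of a product of nonnegative functions of separate variables is the product of their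
sums. -/
lemma hasSum_pi_prod {β : Type*} {f : Fin ℓ → β → ℝ} (hf : ∀ j b, 0 ≤ f j b) {a : Fin ℓ → ℝ}
    (h : ∀ j, HasSum (f j) (a j)) :
    HasSum (fun y : Fin ℓ → β => ∏ j, f j (y j)) (∏ j, a j) := by
  induction ℓ with
  | zero => simp
  | succ n ih =>
    have h2 : HasSum (fun y : Fin n → β => ∏ j, f j.succ (y j)) (∏ j : Fin n, a j.succ) :=
      ih (f := fun j => f j.succ) (fun j b => hf j.succ b) fun j => h j.succ
    have h3 := hasSum_mul_of_nonneg (fun b => hf 0 b)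
      (fun y : Fin n → β => Finset.prod_nonneg fun j _ => hf j.succ (y j)) (h 0) h2
    rw [← (Fin.consEquiv fun _ => β).hasSum_iff, Fin.prod_univ_succ]
    have h4 : (fun y : Fin (n + 1) → β => ∏ j, f j (y j)) ∘ (Fin.consEquiv fun _ => β) = _ :=
      funext fun p => by rw [Function.comp_apply, Fin.prod_univ_succ]
    rw [h4]
    exact h3

lemma prod_ite_eq_mul_prod_erase {ι : Type*} [Fintype ι] [DecidableEq ι] (j : ι) (f g : ι → ℝ) :
    ∏ i, (if i = j then f i else g i) = f j * ∏ i ∈ Finset.univ.erase j, g i := by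
  rw [← Finset.mul_prod_erase _ _ (Finset.mem_univ j), if_pos rfl]
  congr 1
  exact Finset.prod_congr rfl fun i hi => if_neg (Finset.ne_of_mem_erase hi)

lemma negMulLog_prod {ι : Type*} [DecidableEq ι] (s : Finset ι) (a : ι → ℝ) :
    Real.negMulLog (∏ i ∈ s, a i)
      = ∑ j ∈ s, ∏ i ∈ s, if i = j then Real.negMulLog (a i) else a i := by
  induction s using Finset.induction_on with
  | empty => simp
  | insert k s hk ih =>
    rw [Finset.prod_insert hk, Real.negMulLog_mul, ih, Finset.sum_insert hk,
      Finset.prod_insert hk, if_pos rfl, Finset.mul_sum]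
    congr 1
    · rw [mul_comm]
      congr 1
      exact Finset.prod_congr rfl fun i hi => (if_neg (ne_of_mem_of_not_mem hi hk)).symm
    · refine Finset.sum_congr rfl fun j hj => ?_
      rw [Finset.prod_insert hk, if_neg (ne_of_mem_of_not_mem hj hk).symm]

/-- The entropy of a product mass function, by the Leibniz rule for `negMulLog`. -/
lemma massEntropy_pi_prod {X : Type*} [Fintype X] (v : Fin ℓ → X → ℝ) :
    massEntropy (fun x : Fin ℓ → X => ∏ j, v j (x j))
      = ∑ j, ∏ i, if i = j then massEntropy (v i) else ∑ x, v i x := by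
  have hsum : ∀ f : Fin ℓ → X → ℝ, ∑ x : Fin ℓ → X, ∏ j, f j (x j) = ∏ j, ∑ b, f j b := by
    intro f
    rw [Finset.prod_univ_sum, Fintype.piFinset_univ]
  rw [massEntropy, hsum, negMulLog_prod]
  simp only [negMulLog_prod]
  rw [Finset.sum_comm, ← Finset.sum_sub_distrib]
  refine Finset.sum_congr rfl fun j _ => ?_
  rw [hsum fun i b => if i = j then Real.negMulLog (v i b) else v i b]
  have h1 : ∀ i, ∑ b, (if i = j then Real.negMulLog (v i b) else v i b)
      = if i = j then ∑ b, Real.negMulLog (v i b) else ∑ b, v i b := by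
    intro i
    split_ifs <;> rfl
  simp only [h1, prod_ite_eq_mul_prod_erase, massEntropy]
  ring

end Product

/-! ### The chain rule for finite mass functions -/

section ChainRule

/-- The sum of `negMulLog` over a marginal, written as a sum over the whole space. -/
lemma sum_negMulLog_fiber {U β : Type*} [Fintype U] [Fintype β] [DecidableEq β] (v : U → ℝ)
    (φ : U → β) :
    ∑ b, Real.negMulLog (∑ u with φ u = b, v u)
      = ∑ u, -(v u) * Real.log (∑ u' with φ u' = φ u, v u') := by
  rw [← Finset.sum_fiberwise Finset.univ φ]
  refine Finset.sum_congr rfl fun b _ => ?_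
  rw [Real.negMulLog, ← Finset.sum_neg_distrib, Finset.sum_mul]
  refine Finset.sum_congr rfl fun u hu => ?_
  rw [(Finset.mem_filter.1 hu).2]

variable {X : Type*} [Fintype X] [DecidableEq X] {ℓ : ℕ}

/-- The chain rule: revealing the coordinates one after the other, the conditional entropies of
each coordinate given the preceding ones add up to the joint entropy. -/
lemma sum_massEntropy_marginal (v : (Fin ℓ → X) → ℝ) :
    ∑ i : Fin ℓ, ∑ p : Set.Iio i → X,
        massEntropy (fun x => ∑ u : Fin ℓ → X with (∀ j : Set.Iio i, u j = p j) ∧ u i = x, v u)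
      = massEntropy v := by
  -- the joint entropy of the first `m` coordinates
  set T : ℕ → ℝ := fun m =>
    ∑ u, -(v u) * Real.log (∑ u' : Fin ℓ → X with ∀ j : Fin ℓ, j < m → u' j = u j, v u') with hT
  have h1 : ∀ i : Fin ℓ, ∑ p : Set.Iio i → X, ∑ x, Real.negMulLog
      (∑ u : Fin ℓ → X with (∀ j : Set.Iio i, u j = p j) ∧ u i = x, v u) = T (i + 1) := by
    intro i
    rw [← Fintype.sum_prod_type']
    have h := sum_negMulLog_fiber v fun u : Fin ℓ → X => ((fun j : Set.Iio i => u j), u i)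
    simp only [Prod.ext_iff, funext_iff] at h
    rw [h, hT]
    refine Finset.sum_congr rfl fun u _ => ?_
    congr 3
    refine Finset.filter_congr fun u' _ => ?_
    constructor
    · rintro ⟨ha, hb⟩ j hj
      rcases (Nat.lt_succ_iff_lt_or_eq.1 hj) with hj | hj
      · exact ha ⟨j, hj⟩
      · rwa [Fin.ext hj]
    · exact fun ha => ⟨fun j => ha j (Nat.lt_succ_of_lt j.2), ha i (Nat.lt_succ_self _)⟩
  have h2 : ∀ i : Fin ℓ, ∑ p : Set.Iio i → X, Real.negMulLog
      (∑ x, ∑ u : Fin ℓ → X with (∀ j : Set.Iio i, u j = p j) ∧ u i = x, v u) = T i := by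
    intro i
    have h := sum_negMulLog_fiber v fun u : Fin ℓ → X => fun j : Set.Iio i => u j
    simp only [funext_iff] at h
    have h3 : ∀ p : Set.Iio i → X,
        ∑ x, ∑ u : Fin ℓ → X with (∀ j : Set.Iio i, u j = p j) ∧ u i = x, v u
          = ∑ u : Fin ℓ → X with ∀ j : Set.Iio i, u j = p j, v u := by
      intro p
      rw [← Finset.sum_fiberwise _ (fun u : Fin ℓ → X => u i)]
      simp only [Finset.filter_filter]
    simp only [h3]
    rw [h, hT]
    refine Finset.sum_congr rfl fun u _ => ?_
    congr 3
    exact Finset.filter_congr fun u' _ => ⟨fun ha j hj => ha ⟨j, hj⟩, fun ha j => ha j j.2⟩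
  simp only [massEntropy, Finset.sum_sub_distrib, h1, h2]
  rw [← Finset.sum_sub_distrib, Fin.sum_univ_eq_sum_range (fun i => T (i + 1) - T i),
    Finset.sum_range_sub]
  congr 1
  · refine Finset.sum_congr rfl fun u _ => ?_
    have h3 : (Finset.univ.filter fun u' : Fin ℓ → X => ∀ j : Fin ℓ, (j : ℕ) < ℓ → u' j = u j)
        = {u} := by
      ext u'
      simp [funext_iff]
    rw [h3, Finset.sum_singleton, Real.negMulLog]
  · simp [hT, Real.negMulLog, ← Finset.sum_mul]

end ChainRule

/-! ### Conditional entropy of a channel with uniform input -/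

namespace DMC

variable {X : Type} [Fintype X] (W : DMC.{u} X)

/-- The joint probability of the input `x` and the output `y` when the input is uniform. -/
noncomputable def jointProb (y : W.Out) (x : X) : ℝ := 1 / (Fintype.card X : ℝ) * W.prob x y

/-- The conditional entropy, in nats, of a uniform input given the output. -/
noncomputable def condEntropy : ℝ := ∑' y, massEntropy (W.jointProb y)

lemma jointProb_nonneg (y : W.Out) (x : X) : 0 ≤ W.jointProb y x :=
  mul_nonneg (by positivity) (W.prob_nonneg _ _)

lemma hasSum_jointProb (x : X) :
    HasSum (fun y => W.jointProb y x) (1 / (Fintype.card X : ℝ)) := by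
  simpa [jointProb] using (W.hasSum_prob x).mul_left (1 / (Fintype.card X : ℝ))

lemma hasSum_sum_jointProb [Nonempty X] : HasSum (fun y => ∑ x, W.jointProb y x) 1 := by
  have h := hasSum_sum fun x (_ : x ∈ Finset.univ) => W.hasSum_jointProb x
  have h1 : ∑ _x : X, 1 / (Fintype.card X : ℝ) = 1 := by simp
  rwa [h1] at h

lemma summable_jointProb_mul_log (x : X) :
    Summable fun y => W.jointProb y x *
      Real.log ((∑ x', W.jointProb y x') / W.jointProb y x) := by
  have : Nonempty X := ⟨x⟩
  refine Summable.of_nonneg_of_le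
    (fun y => mul_log_sum_div_nonneg (W.jointProb_nonneg y) x) (fun y => ?_)
    W.hasSum_sum_jointProb.summable
  have hs : 0 ≤ ∑ x', W.jointProb y x' := Finset.sum_nonneg fun x' _ => W.jointProb_nonneg y x'
  rcases (W.jointProb_nonneg y x).eq_or_lt with h0 | h0
  · rw [← h0, zero_mul]
    exact hs
  · have h1 := Real.log_le_self (div_nonneg hs h0.le)
    calc _ ≤ W.jointProb y x * ((∑ x', W.jointProb y x') / W.jointProb y x) :=
          mul_le_mul_of_nonneg_left h1 h0.le
      _ = _ := by field_simp

lemma summable_massEntropy_jointProb : Summable fun y => massEntropy (W.jointProb y) := by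
  simp only [massEntropy_eq_sum (W.jointProb_nonneg _)]
  exact summable_sum fun x _ => W.summable_jointProb_mul_log x

lemma condEntropy_nonneg : 0 ≤ W.condEntropy :=
  tsum_nonneg fun y => massEntropy_nonneg (W.jointProb_nonneg y)

lemma condEntropy_le_log_card [Nonempty X] : W.condEntropy ≤ Real.log (Fintype.card X) := by
  have h := W.hasSum_sum_jointProb.mul_left (Real.log (Fintype.card X))
  rw [mul_one] at h
  exact hasSum_le (fun y => massEntropy_le_log_card (W.jointProb_nonneg y))
    W.summable_massEntropy_jointProb.hasSum h

lemma symmetricCapacity_eq (hX : 1 < Fintype.card X) :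
    W.symmetricCapacity = 1 - W.condEntropy / Real.log (Fintype.card X) := by
  have : Nonempty X := Fintype.card_pos_iff.1 (by omega)
  have hq : 0 < (Fintype.card X : ℝ) := by exact_mod_cast Fintype.card_pos
  have hlog : 0 < Real.log (Fintype.card X) := Real.log_pos (by exact_mod_cast hX)
  have term : ∀ x y, 1 / (Fintype.card X : ℝ) * W.prob x y *
      Real.logb (Fintype.card X)
        (W.prob x y / (1 / (Fintype.card X : ℝ) * ∑ x' : X, W.prob x' y))
      = W.jointProb y x - W.jointProb y x *
        Real.log ((∑ x', W.jointProb y x') / W.jointProb y x) / Real.log (Fintype.card X) := by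
    intro x y
    rcases (W.prob_nonneg x y).eq_or_lt with h0 | h0
    · simp [jointProb, ← h0]
    have hs : 0 < ∑ x', W.prob x' y :=
      h0.trans_le (Finset.single_le_sum (f := fun x' => W.prob x' y)
        (fun x' _ => W.prob_nonneg x' y) (Finset.mem_univ x))
    simp only [jointProb, ← Finset.mul_sum]
    rw [mul_div_mul_left _ _ (by positivity), Real.logb, Real.log_div h0.ne' (by positivity),
      Real.log_mul (by positivity) hs.ne', Real.log_div one_ne_zero hq.ne', Real.log_one,
      Real.log_div hs.ne' h0.ne']
    field_simp
    ring
  have hsum : ∀ x, ∑' y, 1 / (Fintype.card X : ℝ) * W.prob x y *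
      Real.logb (Fintype.card X)
        (W.prob x y / (1 / (Fintype.card X : ℝ) * ∑ x' : X, W.prob x' y))
      = 1 / (Fintype.card X : ℝ) - (∑' y, W.jointProb y x *
        Real.log ((∑ x', W.jointProb y x') / W.jointProb y x)) / Real.log (Fintype.card X) := by
    intro x
    simp only [term]
    exact ((W.hasSum_jointProb x).sub
      ((W.summable_jointProb_mul_log x).hasSum.div_const _)).tsum_eq
  rw [symmetricCapacity, Finset.sum_congr rfl fun x _ => hsum x, Finset.sum_sub_distrib,
    condEntropy]
  simp only [massEntropy_eq_sum (W.jointProb_nonneg _)]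
  rw [Summable.tsum_finsetSum fun x _ => W.summable_jointProb_mul_log x,
    Finset.sum_div]
  congr 1
  simp

lemma symmetricCapacity_mem_Icc (hX : 1 < Fintype.card X) :
    W.symmetricCapacity ∈ Set.Icc (0 : ℝ) 1 := by
  have : Nonempty X := Fintype.card_pos_iff.1 (by omega)
  have hlog : 0 < Real.log (Fintype.card X) := Real.log_pos (by exact_mod_cast hX)
  rw [W.symmetricCapacity_eq hX]
  have h1 := (div_le_one hlog).2 W.condEntropy_le_log_card
  have h2 := div_nonneg W.condEntropy_nonneg hlog.le
  constructor <;> linarith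

/-! ### Conservation of the total conditional entropy -/

variable {ℓ : ℕ}

lemma jointProb_subchannel [DecidableEq X] (g : (Fin ℓ → X) → (Fin ℓ → X)) (i : Fin ℓ)
    (y : Fin ℓ → W.Out) (p : Set.Iio i → X) (x : X) :
    (W.subchannel g i).jointProb (y, p) x
      = ∑ u : Fin ℓ → X with (∀ j : Set.Iio i, u j = p j) ∧ u i = x,
          ∏ j, W.jointProb (y j) (g u j) := by
  have h : (Fintype.card X : ℝ) ^ ℓ = (Fintype.card X : ℝ) ^ (ℓ - 1) * Fintype.card X := by
    rw [← pow_succ, Nat.sub_add_cancel i.pos]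
  simp only [jointProb, subchannel, subchannelProb, blockProb, Finset.prod_mul_distrib,
    Finset.prod_const, Finset.card_univ, Fintype.card_fin, ← Finset.mul_sum, ← mul_assoc]
  rw [one_div_pow, h]
  congr 1
  field_simp

lemma hasSum_massEntropy_block [Nonempty X] :
    HasSum (fun y : Fin ℓ → W.Out =>
      massEntropy fun x : Fin ℓ → X => ∏ j, W.jointProb (y j) (x j)) (ℓ * W.condEntropy) := by
  simp only [massEntropy_pi_prod]
  have h : ∀ j : Fin ℓ, HasSum (fun y : Fin ℓ → W.Out =>
      ∏ i, if i = j then massEntropy (W.jointProb (y i)) else ∑ x, W.jointProb (y i) x)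
      W.condEntropy := by
    intro j
    have h1 := hasSum_pi_prod (ℓ := ℓ)
      (f := fun i y => if i = j then massEntropy (W.jointProb y) else ∑ x, W.jointProb y x)
      (a := fun i => if i = j then W.condEntropy else 1)
      (fun i y => by
        split_ifs
        · exact massEntropy_nonneg (W.jointProb_nonneg y)
        · exact Finset.sum_nonneg fun x _ => W.jointProb_nonneg y x)
      (fun i => by
        split_ifs
        · exact W.summable_massEntropy_jointProb.hasSum
        · exact W.hasSum_sum_jointProb)
    simpa using h1
  simpa using hasSum_sum fun j (_ : j ∈ Finset.univ) => h j

theorem sum_condEntropy_subchannel [DecidableEq X] [Nonempty X] {g : (Fin ℓ → X) → (Fin ℓ → X)}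
    (hg : Function.Bijective g) :
    ∑ i, (W.subchannel g i).condEntropy = ℓ * W.condEntropy := by
  have hs : ∀ i, Summable fun o : (Fin ℓ → W.Out) × (Set.Iio i → X) =>
      massEntropy ((W.subchannel g i).jointProb o) :=
    fun i => (W.subchannel g i).summable_massEntropy_jointProb
  have h1 : ∀ i, HasSum (fun y => ∑ p : Set.Iio i → X,
      massEntropy ((W.subchannel g i).jointProb (y, p))) (W.subchannel g i).condEntropy := by
    intro i
    have h2 := (hs i).hasSum.prod_fiberwise fun y => hasSum_fintype _
    exact h2
  refine (hasSum_sum fun i (_ : i ∈ Finset.univ) => h1 i).unique ?_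
  refine W.hasSum_massEntropy_block.congr_fun fun y => ?_
  rw [← massEntropy_comp_equiv _ (Equiv.ofBijective g hg),
    ← sum_massEntropy_marginal]
  refine Finset.sum_congr rfl fun i _ => Finset.sum_congr rfl fun p _ => ?_
  congr 1
  funext x
  rw [jointProb_subchannel]
  rfl

lemma sum_symmetricCapacity_subchannel [DecidableEq X] (hX : 1 < Fintype.card X)
    {g : (Fin ℓ → X) → (Fin ℓ → X)} (hg : Function.Bijective g) :
    ∑ i, (W.subchannel g i).symmetricCapacity = ℓ * W.symmetricCapacity := by
  have : Nonempty X := Fintype.card_pos_iff.1 (by omega)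
  simp only [symmetricCapacity_eq _ hX, Finset.sum_sub_distrib, ← Finset.sum_div,
    W.sum_condEntropy_subchannel hg]
  simp
  ring

end DMC

/-! ### The columns of a polarizing kernel -/

/-- The two columns of the kernel responsible for polarization. Take for `k` the last row of `L`
with an entry off the diagonal. Since all later rows of `L` are diagonal, the columns of `V * L`
with index `k` and with the index of that entry vanish below row `k` and are both nonzero in
row `k`. -/
lemma exists_column_pair {F : Type*} [Field F] {ℓ : ℕ} {G V L : Matrix (Fin ℓ) (Fin ℓ) F}
    {π : Equiv.Perm (Fin ℓ)} (hG : IsUnit G.det) (hV : V.IsUpperTriangular)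
    (hL : L.IsLowerTriangular) (hVLP : G = V * L * π.permMatrix F) (hdiag : ¬ L.IsDiag) :
    ∃ (k a b : Fin ℓ) (γ : F), a ≠ b ∧ γ ≠ 0 ∧ G k a ≠ 0 ∧ (∀ i, k < i → G i a = 0) ∧
      ∀ i, k ≤ i → G i b = γ * G i a := by
  classical
  have hcol : ∀ i c, G i (π c) = ∑ r, V i r * L r c := by
    intro i c
    rw [hVLP, PEquiv.mul_toMatrix_toPEquiv, Matrix.submatrix_apply, id, Equiv.symm_apply_apply,
      Matrix.mul_apply]
  have hdet : (∏ i, V i i) * ∏ i, L i i ≠ 0 := by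
    rw [← Matrix.det_of_isUpperTriangular hV, ← Matrix.det_of_isLowerTriangular L hL]
    intro h
    rw [hVLP, Matrix.det_mul, Matrix.det_mul, h, zero_mul] at hG
    exact not_isUnit_zero hG
  have hVd : ∀ i, V i i ≠ 0 := fun i =>
    Finset.prod_ne_zero_iff.1 (left_ne_zero_of_mul hdet) i (Finset.mem_univ i)
  have hLd : ∀ i, L i i ≠ 0 := fun i =>
    Finset.prod_ne_zero_iff.1 (right_ne_zero_of_mul hdet) i (Finset.mem_univ i)
  set s : Finset (Fin ℓ) := Finset.univ.filter fun k => ∃ j, j ≠ k ∧ L k j ≠ 0 with hs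
  have hne : s.Nonempty := by
    by_contra h
    rw [Finset.not_nonempty_iff_eq_empty] at h
    refine hdiag fun i j hij => ?_
    by_contra hLij
    have : i ∈ s := by simpa [hs] using ⟨j, hij.symm, hLij⟩
    simp [h] at this
  set k := s.max' hne with hk
  obtain ⟨j, hjk, hLkj⟩ : ∃ j, j ≠ k ∧ L k j ≠ 0 := by
    simpa [hs] using s.max'_mem hne
  have hlast : ∀ r, k < r → ∀ c, c ≠ r → L r c = 0 := by
    intro r hr c hc
    by_contra h
    have h1 : r ∈ s := by simpa [hs] using ⟨c, hc, h⟩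
    exact absurd (s.le_max' r h1) (not_le.2 hr)
  have hlt : j < k := by
    refine lt_of_le_of_ne (le_of_not_gt fun h => hLkj (hL ?_)) hjk
    exact h
  have hcolk : ∀ i, G i (π k) = V i k * L k k := by
    intro i
    rw [hcol, Finset.sum_eq_single k (fun r _ hr => ?_) (by simp)]
    rcases lt_or_gt_of_ne hr with h | h
    · rw [hL (show OrderDual.toDual k < OrderDual.toDual r from h), mul_zero]
    · rw [hlast r h k hr.symm, mul_zero]
  have hcolj : ∀ i, k ≤ i → G i (π j) = V i k * L k j := by
    intro i hi
    rw [hcol, Finset.sum_eq_single k (fun r _ hr => ?_) (by simp)]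
    rcases lt_or_gt_of_ne hr with h | h
    · rw [hV (show id r < id i from h.trans_le hi), zero_mul]
    · rw [hlast r h j (hlt.trans h).ne, mul_zero]
  refine ⟨k, π k, π j, L k j / L k k, π.injective.ne hjk.symm, div_ne_zero hLkj (hLd k), ?_, ?_, ?_⟩
  · rw [hcolk]
    exact mul_ne_zero (hVd k) (hLd k)
  · intro i hi
    rw [hcolk, hV (show id k < id i from hi), zero_mul]
  · intro i hi
    rw [hcolk, hcolj i hi]
    field_simp [hLd k]

/-- Along the two columns of `exists_column_pair`, a codeword has one coordinate that is an affine
bijection of `u k` once the past is known, and another which differs from a multiple of the first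
by a function of the past. -/
lemma vecMul_column_pair {F : Type*} [Field F] {ℓ : ℕ} {G : Matrix (Fin ℓ) (Fin ℓ) F}
    {k a b : Fin ℓ} {γ : F} (ha : ∀ i, k < i → G i a = 0) (hb : ∀ i, k ≤ i → G i b = γ * G i a) :
    ∃ f f' : (Set.Iio k → F) → F, ∀ u : Fin ℓ → F,
      Matrix.vecMul u G a = G k a * u k + f (fun j => u j) ∧
      Matrix.vecMul u G b = γ * Matrix.vecMul u G a + f' (fun j => u j) := by
  classical
  let e : (Set.Iio k → F) → Fin ℓ → F := fun p i => if h : i < k then p ⟨i, h⟩ else 0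
  have he : ∀ (u : Fin ℓ → F) i, i < k → e (fun j => u j) i = u i := fun u i hi => by simp [e, hi]
  refine ⟨fun p => ∑ i, e p i * G i a, fun p => ∑ i, e p i * (G i b - γ * G i a), fun u => ⟨?_, ?_⟩⟩
  · rw [← sub_eq_iff_eq_add, Matrix.vecMul_eq_sum, Finset.sum_apply, ← Finset.sum_sub_distrib,
      Finset.sum_eq_single k]
    · simp [e, mul_comm]
    · intro i _ hi
      rcases lt_or_gt_of_ne hi with h | h
      · simp [he u i h]
      · simp [ha i h]
    · simp
  · rw [← sub_eq_iff_eq_add', Matrix.vecMul_eq_sum, Finset.sum_apply, Finset.sum_apply,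
      Finset.mul_sum, ← Finset.sum_sub_distrib]
    refine Finset.sum_congr rfl fun i _ => ?_
    rcases lt_or_ge i k with h | h
    · simp only [he u i h, Pi.smul_apply, smul_eq_mul]
      ring
    · simp only [hb i h, Pi.smul_apply, smul_eq_mul]
      ring

/-! ### The gain of one subchannel -/

/-- Data processing: merging observations, after relabelling the input for each of them, does not
decrease the conditional entropy. The masses `v'` need only dominate the finite merged sums. -/
lemma tsum_massEntropy_le_of_merge {O O' X : Type*} [Fintype X] [DecidableEq O'] {v : O → X → ℝ}
    {v' : O' → X → ℝ} (hv : ∀ o x, 0 ≤ v o x) (hv' : ∀ o x, 0 ≤ v' o x)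
    (hs : Summable fun o' => massEntropy (v' o')) (φ : O → O') (σ : O → Equiv.Perm X)
    (h : ∀ (s : Finset O) o' x, ∑ o ∈ s with φ o = o', v o (σ o x) ≤ v' o' x) :
    ∑' o, massEntropy (v o) ≤ ∑' o', massEntropy (v' o') := by
  refine Real.tsum_le_of_sum_le (fun o => massEntropy_nonneg (hv o)) fun s => ?_
  rw [← Finset.sum_fiberwise_of_maps_to (t := s.image φ)
    fun o ho => Finset.mem_image_of_mem φ ho]
  refine (Finset.sum_le_sum fun o' _ => ?_).trans
    (hs.sum_le_tsum _ fun o' _ => massEntropy_nonneg (hv' o'))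
  rw [Finset.sum_congr rfl fun o _ => (massEntropy_comp_equiv (v o) (σ o)).symm]
  refine (sum_massEntropy_le _ fun o x => hv o (σ o x)).trans ?_
  exact massEntropy_mono (fun x => Finset.sum_nonneg fun o _ => hv o _) fun x => h s o' x

lemma hasSum_prod_fintype {O X : Type*} [Fintype X] {f : O → X → ℝ} (hf : ∀ o x, 0 ≤ f o x)
    {a : ℝ} (h : HasSum (fun o => ∑ x, f o x) a) : HasSum (fun p : O × X => f p.1 p.2) a := by
  have hs : Summable fun p : O × X => f p.1 p.2 := by
    refine (summable_prod_of_nonneg fun p => hf p.1 p.2).2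
      ⟨fun o => (hasSum_fintype _).summable, ?_⟩
    simpa [tsum_fintype] using h.summable
  have h1 := hs.hasSum.prod_fiberwise fun o => hasSum_fintype _
  rw [← h1.unique h]
  exact hs.hasSum

lemma sq_sqrt_sub_sqrt_le {a b : ℝ} (ha : 0 ≤ a) (hb : 0 ≤ b) : (√a - √b) ^ 2 ≤ a + b := by
  nlinarith [Real.sq_sqrt ha, Real.sq_sqrt hb, mul_nonneg (Real.sqrt_nonneg a) (Real.sqrt_nonneg b)]

namespace DMC

section Gain

variable {X : Type} [Fintype X] (W : DMC.{u} X)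

/-- How hard the inputs `z` and `z'` are to tell apart: the mass common to their output
distributions. -/
noncomputable def overlap (z z' : X) : ℝ := ∑' y, min (W.jointProb y z) (W.jointProb y z')

lemma summable_overlap (z z' : X) :
    Summable fun y => min (W.jointProb y z) (W.jointProb y z') :=
  Summable.of_nonneg_of_le (fun y => le_min (W.jointProb_nonneg y z) (W.jointProb_nonneg y z'))
    (fun _ => min_le_left _ _) (W.hasSum_jointProb z).summable

variable [Field X]

/-- The squared Hellinger distance between the outputs for `z + c` and `z' + c`, summed over all
shifts `c`. -/
noncomputable def shiftDist (z z' : X) : ℝ :=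
  ∑' p : W.Out × X, (√(W.jointProb p.1 (z + p.2)) - √(W.jointProb p.1 (z' + p.2))) ^ 2

lemma hasSum_jointProb_prod (x : X) :
    HasSum (fun p : W.Out × X => W.jointProb p.1 (x + p.2)) 1 := by
  refine hasSum_prod_fintype (f := fun y c => W.jointProb y (x + c))
    (fun y c => W.jointProb_nonneg y _) ?_
  refine W.hasSum_sum_jointProb.congr_fun fun y => ?_
  exact Equiv.sum_comp (Equiv.addLeft x) fun c => W.jointProb y c

lemma summable_shiftDist (z z' : X) : Summable fun p : W.Out × X =>
    (√(W.jointProb p.1 (z + p.2)) - √(W.jointProb p.1 (z' + p.2))) ^ 2 :=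
  Summable.of_nonneg_of_le (fun _ => sq_nonneg _)
    (fun _ => sq_sqrt_sub_sqrt_le (W.jointProb_nonneg _ _) (W.jointProb_nonneg _ _))
    ((W.hasSum_jointProb_prod z).add (W.hasSum_jointProb_prod z')).summable

/-- The joint mass of an input `z` and of two looks at it: the output of `W` on `z`, and the output
of `W` on `γ * z + c` together with the independent uniform shift `c`. -/
noncomputable def twoLookProb (γ : X) (o : W.Out × W.Out × X) (z : X) : ℝ :=
  W.jointProb o.1 z * W.jointProb o.2.1 (γ * z + o.2.2)

/-- The second look reduces the conditional entropy: inputs which the first look confuses are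
separated by the second one as far as `shiftDist` allows. -/
lemma tsum_massEntropy_twoLookProb_add_le (γ z z' : X) :
    (Summable fun o => massEntropy (W.twoLookProb γ o)) ∧
      ∑' o, massEntropy (W.twoLookProb γ o)
        + 1 / 2 * (W.overlap z z' * W.shiftDist (γ * z) (γ * z')) ≤ W.condEntropy := by
  have hm := W.jointProb_nonneg
  have hR : HasSum (fun o : W.Out × W.Out × X => ∑ x, W.jointProb o.2.1 (γ * x + o.2.2) *
      (W.jointProb o.1 x * Real.log ((∑ x', W.jointProb o.1 x') / W.jointProb o.1 x)))
      W.condEntropy := by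
    have h1 : ∀ x : X, HasSum (fun o : W.Out × W.Out × X => W.jointProb o.2.1 (γ * x + o.2.2) *
      (W.jointProb o.1 x * Real.log ((∑ x', W.jointProb o.1 x') / W.jointProb o.1 x)))
      (∑' y, W.jointProb y x * Real.log ((∑ x', W.jointProb y x') / W.jointProb y x)) := by
      intro x
      have h2 := hasSum_mul_of_nonneg
        (fun y => mul_log_sum_div_nonneg (W.jointProb_nonneg y) x)
        (fun p : W.Out × X => hm p.1 (γ * x + p.2))
        (W.summable_jointProb_mul_log x).hasSum (W.hasSum_jointProb_prod (γ * x))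
      rw [mul_one] at h2
      exact h2.congr_fun fun o => mul_comm _ _
    have h3 := hasSum_sum fun x (_ : x ∈ Finset.univ) => h1 x
    rw [← Summable.tsum_finsetSum fun x _ => W.summable_jointProb_mul_log x] at h3
    simpa only [condEntropy, massEntropy_eq_sum (W.jointProb_nonneg _)] using h3
  have hgap := fun o : W.Out × W.Out × X => massEntropy_mul_add_le (hm o.1)
    (fun x => hm o.2.1 (γ * x + o.2.2)) z z'
  have hD : HasSum (fun o : W.Out × W.Out × X =>
      1 / 2 * (min (W.jointProb o.1 z) (W.jointProb o.1 z') *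
        (√(W.jointProb o.2.1 (γ * z + o.2.2)) - √(W.jointProb o.2.1 (γ * z' + o.2.2))) ^ 2))
      (1 / 2 * (W.overlap z z' * W.shiftDist (γ * z) (γ * z'))) :=
    (hasSum_mul_of_nonneg (fun y => le_min (hm y z) (hm y z')) (fun p => sq_nonneg _)
      (W.summable_overlap z z').hasSum (W.summable_shiftDist (γ * z) (γ * z')).hasSum).mul_left _
  have hnn : ∀ o, 0 ≤ massEntropy (W.twoLookProb γ o) :=
    fun o => massEntropy_nonneg fun x => mul_nonneg (hm _ _) (hm _ _)
  have hs : Summable fun o => massEntropy (W.twoLookProb γ o) := by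
    refine Summable.of_nonneg_of_le hnn (fun o => ?_) hR.summable
    refine le_trans (le_add_of_nonneg_right ?_) (hgap o)
    exact mul_nonneg (mul_nonneg (by norm_num) (le_min (hm _ _) (hm _ _))) (sq_nonneg _)
  refine ⟨hs, hasSum_le (fun o => ?_) (hs.hasSum.add hD) hR⟩
  rw [← mul_assoc]
  exact hgap o

variable [DecidableEq X] {ℓ : ℕ}

/-- If, given the past, one coordinate of `g u` is an affine bijection of `u k` and another one is
an affine function of the first, then the subchannel `k` is at least as informative as two looks
at its input. -/
lemma condEntropy_subchannel_le_twoLook {g : (Fin ℓ → X) → (Fin ℓ → X)}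
    (hg : Function.Bijective g) {k a b : Fin ℓ} (hab : a ≠ b) {α γ : X} (hα : α ≠ 0)
    {f f' : (Set.Iio k → X) → X} (hga : ∀ u, g u a = α * u k + f (fun j => u j))
    (hgb : ∀ u, g u b = γ * g u a + f' (fun j => u j))
    (hs : Summable fun o => massEntropy (W.twoLookProb γ o)) :
    (W.subchannel g k).condEntropy ≤ ∑' o, massEntropy (W.twoLookProb γ o) := by
  classical
  have hm := W.jointProb_nonneg
  -- the value of `u k` for which coordinate `a` of the codeword is `z`
  let σ : (Fin ℓ → W.Out) × (Set.Iio k → X) → Equiv.Perm X := fun o =>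
    (Equiv.subRight (f o.2)).trans (Equiv.mulLeft₀ α⁻¹ (inv_ne_zero hα))
  let φ : (Fin ℓ → W.Out) × (Set.Iio k → X) → W.Out × W.Out × X :=
    fun o => (o.1 a, o.1 b, f' o.2)
  refine tsum_massEntropy_le_of_merge (W.subchannel g k).jointProb_nonneg
    (fun o x => mul_nonneg (hm _ _) (hm _ _)) hs φ σ ?_
  rintro (s : Finset ((Fin ℓ → W.Out) × (Set.Iio k → X))) ⟨y₁, y₂, c⟩ z
  -- the joint law of all letters and outputs, with the two letters and outputs of interest fixed
  let K : Fin ℓ → W.Out × X → ℝ := fun j p =>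
    if j = a then (if p = (y₁, z) then W.jointProb y₁ z else 0)
    else if j = b then (if p = (y₂, γ * z + c) then W.jointProb y₂ (γ * z + c) else 0)
    else W.jointProb p.1 p.2
  have hK0 : ∀ j p, 0 ≤ K j p := by
    intro j p
    simp only [K]
    split_ifs <;> first | exact le_rfl | exact hm _ _
  have hK : ∀ j, HasSum (K j) (if j = a then W.jointProb y₁ z else
      if j = b then W.jointProb y₂ (γ * z + c) else 1) := by
    intro j
    simp only [K]
    split_ifs
    · exact hasSum_ite_eq _ _
    · exact hasSum_ite_eq _ _
    · simpa using W.hasSum_jointProb_prod 0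
  have htot := hasSum_pi_prod hK0 hK
  rw [Fintype.prod_eq_mul a b hab (fun j hj => by rw [if_neg hj.1, if_neg hj.2]), if_pos rfl,
    if_neg hab.symm, if_pos rfl] at htot
  let ι : ((Fin ℓ → W.Out) × (Set.Iio k → X)) × (Fin ℓ → X) → Fin ℓ → W.Out × X :=
    fun t j => (t.1.1 j, g t.2 j)
  let S := ((s.filter fun o => φ o = (y₁, y₂, c)) ×ˢ (Finset.univ : Finset (Fin ℓ → X))).filter
    fun t => (∀ j : Set.Iio k, t.2 j = t.1.2 j) ∧ t.2 k = σ t.1 z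
  have hS : ∀ t ∈ S, φ t.1 = (y₁, y₂, c) ∧ (fun j : Set.Iio k => t.2 j) = t.1.2 ∧
      t.2 k = σ t.1 z := by
    intro t ht
    simp only [S, Finset.mem_filter, Finset.mem_product] at ht
    exact ⟨ht.1.1.2, funext ht.2.1, ht.2.2⟩
  have hinj : Set.InjOn ι S := by
    rintro ⟨⟨y, p⟩, u⟩ ht ⟨⟨y', p'⟩, u'⟩ ht' h
    have h1 : y = y' := funext fun j => (Prod.ext_iff.1 (congrFun h j)).1
    have h2 : u = u' := hg.1 (funext fun j => (Prod.ext_iff.1 (congrFun h j)).2)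
    have h3 : p = p' := (hS _ ht).2.1.symm.trans (h2 ▸ (hS _ ht').2.1)
    rw [h1, h2, h3]
  have hterm : ∀ t ∈ S, ∏ j, W.jointProb (t.1.1 j) (g t.2 j) = ∏ j, K j (ι t j) := by
    intro t ht
    obtain ⟨h1, h2, h3⟩ := hS t ht
    have ha : g t.2 a = z := by
      rw [hga, h2, h3]
      simp [σ, hα]
    have hb : g t.2 b = γ * z + c := by
      have hc : f' t.1.2 = c := (Prod.ext_iff.1 (Prod.ext_iff.1 h1).2).2
      rw [hgb, h2, ha, hc]
    have hya : t.1.1 a = y₁ := (Prod.ext_iff.1 h1).1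
    have hyb : t.1.1 b = y₂ := (Prod.ext_iff.1 (Prod.ext_iff.1 h1).2).1
    refine Finset.prod_congr rfl fun j _ => ?_
    simp only [K, ι]
    split_ifs with hj1 hj2 hj3 hj4
    · rw [hj1, hya, ha]
    · exact absurd (by rw [hj1, hya, ha]) hj2
    · rw [hj3, hyb, hb]
    · exact absurd (by rw [hj3, hyb, hb]) hj4
    · rfl
  calc ∑ o ∈ s with φ o = (y₁, y₂, c), (W.subchannel g k).jointProb o (σ o z)
      = ∑ t ∈ S, ∏ j, W.jointProb (t.1.1 j) (g t.2 j) := by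
        rw [Finset.sum_filter (s := _ ×ˢ _), Finset.sum_product]
        refine Finset.sum_congr rfl fun o _ => ?_
        rw [← Finset.sum_filter]
        exact W.jointProb_subchannel g k o.1 o.2 _
    _ = ∑ t ∈ S, ∏ j, K j (ι t j) := Finset.sum_congr rfl hterm
    _ = ∑ x ∈ S.image ι, ∏ j, K j (x j) := 
        (Finset.sum_image (f := fun x : Fin ℓ → W.Out × X => ∏ j, K j (x j)) hinj).symm
    _ ≤ W.jointProb y₁ z * W.jointProb y₂ (γ * z + c) :=
        sum_le_hasSum _ (fun x _ => Finset.prod_nonneg fun j _ => hK0 j _) htot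

end Gain

end DMC

/-! ### Uniform gain away from the extreme capacities -/

/-- In a prime field any nonzero step connects any two points, so a function whose increments along
a single step are small is nearly constant. -/
lemma ZMod.sq_sub_le_sum_sq_sub {q : ℕ} [Fact q.Prime] (f : ZMod q → ℝ) {a b : ZMod q} (hab : a ≠ b)
    (x x' : ZMod q) :
    (f x - f x') ^ 2 ≤ (q : ℝ) ^ 2 * ∑ c, (f (a + c) - f (b + c)) ^ 2 := by
  set T := ∑ c, (f (a + c) - f (b + c)) ^ 2 with hT
  have hT0 : 0 ≤ T := Finset.sum_nonneg fun c _ => sq_nonneg _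
  have hstep : ∀ y, |f y - f (y + (b - a))| ≤ √T := by
    intro y
    refine Real.abs_le_sqrt ?_
    have h := Finset.single_le_sum (f := fun c => (f (a + c) - f (b + c)) ^ 2)
      (fun c _ => sq_nonneg _) (Finset.mem_univ (y - a))
    have h1 : a + (y - a) = y := by ring
    have h2 : b + (y - a) = y + (b - a) := by ring
    simpa only [h1, h2] using h
  have hsteps : ∀ n : ℕ, |f x - f (x + n * (b - a))| ≤ n * √T := by
    intro n
    induction n with
    | zero => simp
    | succ n ih =>
      have h1 : x + ((n + 1 : ℕ) : ZMod q) * (b - a) = x + n * (b - a) + (b - a) := by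
        push_cast
        ring
      have h2 := abs_sub_le (f x) (f (x + n * (b - a))) (f (x + n * (b - a) + (b - a)))
      have h3 := hstep (x + n * (b - a))
      rw [h1]
      push_cast
      linarith
  have hba : b - a ≠ 0 := sub_ne_zero.2 hab.symm
  have hn := hsteps ((x' - x) / (b - a)).val
  rw [ZMod.natCast_val, ZMod.cast_id', id, div_mul_cancel₀ _ hba, add_sub_cancel] at hn
  have hlt : ((((x' - x) / (b - a)).val : ℕ) : ℝ) ≤ q := by exact_mod_cast (ZMod.val_lt _).le
  have h1 : |f x - f x'| ≤ q * √T :=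
    hn.trans (mul_le_mul_of_nonneg_right hlt (Real.sqrt_nonneg _))
  calc (f x - f x') ^ 2 = |f x - f x'| ^ 2 := (sq_abs _).symm
    _ ≤ (q * √T) ^ 2 := pow_le_pow_left₀ (abs_nonneg _) h1 2
    _ = q ^ 2 * T := by rw [mul_pow, Real.sq_sqrt hT0]

namespace DMC

/-- If the output does not determine the input, then some two inputs have overlapping output
distributions. -/
lemma condEntropy_le_add_sum_overlap {X : Type} [Fintype X] [Nonempty X] [DecidableEq X]
    (W : DMC.{u} X) {K : ℝ} (hK : 1 ≤ K) :
    W.condEntropy ≤ Fintype.card X / K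
      + K * ∑ a, ∑ b ∈ Finset.univ.erase a, W.overlap a b := by
  have h1 := W.hasSum_sum_jointProb.mul_left (Fintype.card X / K)
  have h2 := (hasSum_sum fun a (_ : a ∈ Finset.univ) =>
    hasSum_sum fun b (_ : b ∈ Finset.univ.erase a) => (W.summable_overlap a b).hasSum).mul_left K
  have h3 := hasSum_le (fun y => massEntropy_le_add_sum_min (W.jointProb_nonneg y) hK)
    W.summable_massEntropy_jointProb.hasSum (h1.add h2)
  rwa [mul_one] at h3

variable {q : ℕ} [Fact q.Prime] {ℓ : ℕ}

/-- If the output carries some information on the input, then two looks at different shifts of it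
can be told apart. -/
lemma log_sub_condEntropy_le_shiftDist (W : DMC.{u} (ZMod q)) {a b : ZMod q} (hab : a ≠ b) :
    Real.log q - W.condEntropy ≤ 2 * (q : ℝ) ^ 4 * W.shiftDist a b := by
  have h1 := (W.hasSum_sum_jointProb.mul_left (Real.log q)).sub
    W.summable_massEntropy_jointProb.hasSum
  have h2 := ((W.summable_shiftDist a b).hasSum.prod_fiberwise
    fun y => hasSum_fintype _).mul_left (2 * (q : ℝ) ^ 4)
  rw [mul_one] at h1
  refine hasSum_le (fun y => ?_) h1 h2
  have h3 := log_card_mul_sub_massEntropy_le (W.jointProb_nonneg y)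
  rw [ZMod.card] at h3
  refine h3.trans ?_
  have h4 : ∑ x : ZMod q, ∑ x' : ZMod q, (√(W.jointProb y x) - √(W.jointProb y x')) ^ 2
      ≤ ∑ _x : ZMod q, ∑ _x' : ZMod q, (q : ℝ) ^ 2 *
        ∑ c, (√(W.jointProb y (a + c)) - √(W.jointProb y (b + c))) ^ 2 :=
    Finset.sum_le_sum fun x _ => Finset.sum_le_sum fun x' _ =>
      ZMod.sq_sub_le_sum_sq_sub (fun x => √(W.jointProb y x)) hab x x'
  simp only [Finset.sum_const, Finset.card_univ, ZMod.card, nsmul_eq_mul] at h4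
  linarith

/-- The gain of the polarizing subchannel is bounded below in terms of `δ` alone, uniformly over
all channels whose capacity is at least `δ` away from `0` and `1`. -/
theorem exists_gain {g : (Fin ℓ → ZMod q) → (Fin ℓ → ZMod q)} (hg : Function.Bijective g)
    {k a b : Fin ℓ} (hab : a ≠ b) {α γ : ZMod q} (hα : α ≠ 0) (hγ : γ ≠ 0)
    {f f' : (Set.Iio k → ZMod q) → ZMod q} (hga : ∀ u, g u a = α * u k + f (fun j => u j))
    (hgb : ∀ u, g u b = γ * g u a + f' (fun j => u j)) {δ : ℝ} (hδ : 0 < δ) :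
    ∃ ε > 0, ∀ W : DMC.{u} (ZMod q), W.symmetricCapacity ∈ Set.Icc δ (1 - δ) →
      W.symmetricCapacity + ε ≤ (W.subchannel g k).symmetricCapacity := by
  have hq1 : 1 < Fintype.card (ZMod q) := by
    rw [ZMod.card]
    exact (Fact.out : q.Prime).one_lt
  have hq : 1 < (q : ℝ) := by exact_mod_cast (Fact.out : q.Prime).one_lt
  have hq0 : 0 < (q : ℝ) := by linarith
  have hlog : 0 < Real.log q := Real.log_pos hq
  -- `t` is the margin in nats, `s` a lower bound for `shiftDist`; with this `K` the first term of
  -- `condEntropy_le_add_sum_overlap` takes up only half of the entropy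
  set t := δ * Real.log q with ht
  have ht0 : 0 < t := mul_pos hδ hlog
  set s := t / (2 * (q : ℝ) ^ 4) with hs
  have hs0 : 0 < s := by positivity
  set K := 2 * q / t with hK
  have hK0 : 0 < K := by positivity
  refine ⟨t * s / (4 * K * q ^ 2) / Real.log q, by positivity, fun W hW => ?_⟩
  have hcap := W.symmetricCapacity_eq hq1
  have hcap' := (W.subchannel g k).symmetricCapacity_eq hq1
  rw [ZMod.card] at hcap hcap'
  rw [hcap] at hW ⊢
  rw [hcap']
  set H := W.condEntropy
  set H' := (W.subchannel g k).condEntropy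
  have hlow : t ≤ Real.log q - H := by
    have h := mul_le_mul_of_nonneg_right hW.1 hlog.le
    rw [sub_mul, div_mul_cancel₀ _ hlog.ne', one_mul] at h
    exact h
  have hhigh : t ≤ H := by
    have h := mul_le_mul_of_nonneg_right hW.2 hlog.le
    rw [sub_mul, div_mul_cancel₀ _ hlog.ne', sub_mul, one_mul] at h
    linarith
  have hK1 : 1 ≤ K := by
    rw [hK, le_div_iff₀ ht0, one_mul]
    have h1 := Real.log_le_self hq0.le
    have h2 : H ≤ Real.log q := by linarith
    linarith
  have hpair : ∀ z z' : ZMod q, z ≠ z' → W.overlap z z' ≤ 2 * (H - H') / s := by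
    intro z z' hz
    obtain ⟨hsum, hle⟩ := W.tsum_massEntropy_twoLookProb_add_le γ z z'
    have h1 := W.condEntropy_subchannel_le_twoLook hg hab hα hga hgb hsum
    have h2 := W.log_sub_condEntropy_le_shiftDist ((mul_right_injective₀ hγ).ne hz)
    have h3 : s ≤ W.shiftDist (γ * z) (γ * z') := by
      rw [hs, div_le_iff₀ (by positivity)]
      linarith
    have h4 : 0 ≤ W.overlap z z' :=
      tsum_nonneg fun y => le_min (W.jointProb_nonneg y z) (W.jointProb_nonneg y z')
    rw [le_div_iff₀ hs0]
    nlinarith [mul_le_mul_of_nonneg_left h3 h4]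
  have hgain0 : 0 ≤ 2 * (H - H') / s := by
    refine le_trans ?_ (hpair 0 1 zero_ne_one)
    exact tsum_nonneg fun y => le_min (W.jointProb_nonneg y 0) (W.jointProb_nonneg y 1)
  have htotal : ∑ z : ZMod q, ∑ z' ∈ Finset.univ.erase z, W.overlap z z'
      ≤ q ^ 2 * (2 * (H - H') / s) := by
    have h1 : ∑ z : ZMod q, ∑ z' ∈ Finset.univ.erase z, W.overlap z z'
        ≤ ∑ _z : ZMod q, ∑ _z' : ZMod q, 2 * (H - H') / s := by
      refine Finset.sum_le_sum fun z _ => ?_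
      refine (Finset.sum_le_sum fun z' hz' => hpair z z' (Finset.ne_of_mem_erase hz').symm).trans ?_
      exact Finset.sum_le_sum_of_subset_of_nonneg (Finset.erase_subset _ _) fun _ _ _ => hgain0
    simp only [Finset.sum_const, Finset.card_univ, ZMod.card, nsmul_eq_mul] at h1
    rw [sq, mul_assoc]
    exact h1
  have hH := W.condEntropy_le_add_sum_overlap hK1
  rw [ZMod.card] at hH
  have hfirst : (q : ℝ) / K = t / 2 := by
    rw [hK]
    field_simp
  have hfinal : t * s / (4 * K * q ^ 2) ≤ H - H' := by
    have h1 : t / 2 ≤ K * (q ^ 2 * (2 * (H - H') / s)) := by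
      have h2 := mul_le_mul_of_nonneg_left htotal hK0.le
      linarith
    rw [div_le_iff₀ (by positivity)]
    have h3 : K * (q ^ 2 * (2 * (H - H') / s)) = 2 * K * q ^ 2 * (H - H') / s := by ring
    rw [h3, le_div_iff₀ hs0] at h1
    linarith
  have h := div_le_div_of_nonneg_right hfinal hlog.le
  rw [sub_div] at h
  linarith

end DMC

/-! ### The capacity process -/

section UniformIndices

variable {Ω : Type*} [mΩ : MeasurableSpace Ω] {ℓ : ℕ} {B : ℕ → Ω → Fin ℓ}

/-- A functional of the first `n` terms of a sequence with values in a finite set is measurable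
with respect to the past `σ(B₀, …, Bₙ₋₁)`. -/
lemma stronglyMeasurable_pastFiltration [NeZero ℓ] (hB : ∀ n, Measurable (B n)) {n : ℕ}
    {F : (ℕ → Fin ℓ) → ℝ} (hF : ∀ b b', (∀ j < n, b j = b' j) → F b = F b') :
    StronglyMeasurable[pastFiltration B hB n] fun ω => F fun k => B k ω := by
  classical
  let e : (Set.Iio n → Fin ℓ) → ℕ → Fin ℓ := fun p j => if h : j < n then p ⟨j, h⟩ else 0
  have h1 : Measurable[pastFiltration B hB n] fun ω (j : Set.Iio n) => B j ω := by
    refine @measurable_pi_lambda _ _ _ (_) _ _ fun j => ?_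
    refine Measurable.mono (comap_measurable (B j)) ?_ le_rfl
    exact le_iSup₂_of_le (f := fun i (_ : i ∈ Set.Iio n) =>
      MeasurableSpace.comap (B i) inferInstance) j.1 j.2 le_rfl
  have h2 : Measurable fun p : Set.Iio n → Fin ℓ => F (e p) := measurable_of_countable _
  have h3 : (fun ω => F fun k => B k ω)
      = (fun p => F (e p)) ∘ fun ω (j : Set.Iio n) => B j ω := by
    funext ω
    exact hF _ _ fun j hj => by simp [e, hj]
  rw [h3]
  exact (h2.comp h1).stronglyMeasurable

lemma indep_comap_pastFiltration {μ : Measure Ω} (hB : ∀ n, Measurable (B n))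
    (hindep : iIndepFun B μ) (n : ℕ) :
    Indep (MeasurableSpace.comap (B n) inferInstance) (pastFiltration B hB n) μ := by
  have h := indep_iSup_of_disjoint (fun j => (hB j).comap_le) hindep
    (S := {n}) (T := Set.Iio n) (by simp)
  rw [iSup_singleton] at h
  exact h

/-- The average over the next index: conditionally on the past, `Bₙ` is still uniform. -/
lemma condExp_pastFiltration_eq {μ : Measure Ω} [IsProbabilityMeasure μ]
    (hB : ∀ n, Measurable (B n)) (hindep : iIndepFun B μ)
    (hunif : ∀ n b, μ (B n ⁻¹' {b}) = (ℓ : ENNReal)⁻¹) (n : ℕ) {h : Fin ℓ → Ω → ℝ}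
    (hmeas : ∀ b, StronglyMeasurable[pastFiltration B hB n] (h b)) {C : ℝ}
    (hbdd : ∀ b ω, ‖h b ω‖ ≤ C) :
    μ[fun ω => h (B n ω) ω | pastFiltration B hB n] =ᵐ[μ] fun ω => (ℓ : ℝ)⁻¹ * ∑ b, h b ω := by
  have hle : pastFiltration B hB n ≤ mΩ := (pastFiltration B hB).le n
  set D : Fin ℓ → Ω → ℝ := fun b => (B n ⁻¹' {b}).indicator 1 with hD
  have hset : ∀ b, MeasurableSet (B n ⁻¹' {b}) := fun b => hB n (measurableSet_singleton b)
  have hDint : ∀ b, Integrable (D b) μ := fun b => (integrable_const 1).indicator (hset b)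
  have hprod : ∀ b, Integrable (h b * D b) μ := by
    intro b
    exact (hDint b).bdd_mul ((hmeas b).mono hle).aestronglyMeasurable
      (Eventually.of_forall fun ω => hbdd b ω)
  have hsplit : (fun ω => h (B n ω) ω) = ∑ b, h b * D b := by
    funext ω
    rw [Finset.sum_apply, Finset.sum_eq_single (B n ω)]
    · simp [hD]
    · intro b _ hb
      simp [hD, Set.indicator_of_notMem (show ω ∉ B n ⁻¹' {b} from fun h => hb h.symm)]
    · simp
  have hcond : ∀ b, μ[D b | pastFiltration B hB n] =ᵐ[μ] fun _ => (ℓ : ℝ)⁻¹ := by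
    intro b
    have hDm : StronglyMeasurable[MeasurableSpace.comap (B n) inferInstance] (D b) :=
      StronglyMeasurable.indicator (@stronglyMeasurable_const _ _ (_) _ 1)
        ⟨{b}, measurableSet_singleton b, rfl⟩
    have h1 := condExp_indep_eq (hB n).comap_le hle hDm (indep_comap_pastFiltration hB hindep n)
    rw [hD, integral_indicator_one (hset b), Measure.real, hunif] at h1
    simpa using h1
  rw [hsplit]
  refine (condExp_finsetSum (fun b _ => hprod b) _).trans ?_
  have hterm : ∀ᵐ ω ∂μ, ∀ b, μ[h b * D b | pastFiltration B hB n] ω = h b ω * (ℓ : ℝ)⁻¹ := by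
    refine ae_all_iff.2 fun b => ?_
    filter_upwards [condExp_mul_of_stronglyMeasurable_left (hmeas b) (hprod b) (hDint b), hcond b]
      with ω h1 h2
    rw [h1, Pi.mul_apply, h2]
  filter_upwards [hterm] with ω hω
  rw [Finset.sum_apply, Finset.sum_congr rfl fun b _ => hω b, ← Finset.sum_mul, mul_comm]

/-- Each index occurs infinitely often in an independent uniform sequence. -/
lemma ae_frequently_eq {μ : Measure Ω} [NeZero ℓ] (hB : ∀ n, Measurable (B n))
    (hindep : iIndepFun B μ) (hunif : ∀ n b, μ (B n ⁻¹' {b}) = (ℓ : ENNReal)⁻¹) (k : Fin ℓ) :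
    ∀ᵐ ω ∂μ, ∃ᶠ n in atTop, B n ω = k := by
  have := hindep.isProbabilityMeasure
  have hset : ∀ n, MeasurableSet (B n ⁻¹' {k}) := fun n => hB n (measurableSet_singleton k)
  have hind : iIndepSet (fun n => B n ⁻¹' {k}) μ := by
    rw [iIndepSet_iff_meas_biInter hset]
    exact fun s => hindep.measure_inter_preimage_eq_mul s fun _ _ => measurableSet_singleton k
  have hsum : ∑' n, μ (B n ⁻¹' {k}) = ⊤ := by
    simp only [hunif]
    exact ENNReal.tsum_const_eq_top_of_ne_zero (by simp)
  have h := measure_limsup_eq_one hset hind hsum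
  have h1 := (mem_ae_iff_prob_eq_one (MeasurableSet.measurableSet_limsup hset)).2 h
  filter_upwards [h1] with ω hω
  rw [mem_limsup_iff_frequently_mem] at hω
  exact hω

end UniformIndices

namespace DMC

lemma iterSubchannel_congr {X : Type} [Fintype X] [DecidableEq X] {ℓ : ℕ} (W : DMC.{u} X)
    (g : (Fin ℓ → X) → (Fin ℓ → X)) {b b' : ℕ → Fin ℓ} {n : ℕ} (h : ∀ j < n, b j = b' j) :
    W.iterSubchannel g b n = W.iterSubchannel g b' n := by
  induction n with
  | zero => rfl
  | succ n ih =>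
    rw [iterSubchannel, iterSubchannel, ih fun j hj => h j (Nat.lt_succ_of_lt hj),
      h n (Nat.lt_succ_self n)]

/-- The capacity process is a martingale, because the capacities of the subchannels of any channel
average to its own capacity. -/
theorem martingale_symmetricCapacity {X : Type} [Fintype X] [DecidableEq X] {ℓ : ℕ} [NeZero ℓ]
    (W : DMC.{u} X) (hX : 1 < Fintype.card X) {g : (Fin ℓ → X) → (Fin ℓ → X)}
    (hg : Function.Bijective g) {Ω : Type*} [MeasurableSpace Ω] {μ : Measure Ω}
    [IsProbabilityMeasure μ] {B : ℕ → Ω → Fin ℓ} (hB : ∀ n, Measurable (B n))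
    (hindep : iIndepFun B μ) (hunif : ∀ n b, μ (B n ⁻¹' {b}) = (ℓ : ENNReal)⁻¹) :
    Martingale (fun n ω => (W.iterSubchannel g (fun k => B k ω) n).symmetricCapacity)
      (pastFiltration B hB) μ := by
  have hnorm : ∀ W : DMC.{u} X, ‖W.symmetricCapacity‖ ≤ 1 := by
    intro W
    have h := W.symmetricCapacity_mem_Icc hX
    rw [Real.norm_eq_abs, abs_of_nonneg h.1]
    exact h.2
  have hadp : StronglyAdapted (pastFiltration B hB)
      fun n ω => (W.iterSubchannel g (fun k => B k ω) n).symmetricCapacity := fun n =>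
    stronglyMeasurable_pastFiltration hB (n := n)
      (F := fun b => (W.iterSubchannel g b n).symmetricCapacity)
      fun b b' h => by rw [W.iterSubchannel_congr g h]
  refine martingale_nat hadp (fun n => ?_) fun n => ?_
  · exact Integrable.of_bound ((hadp n).mono ((pastFiltration B hB).le n)).aestronglyMeasurable 1
      (Eventually.of_forall fun ω => hnorm _)
  · have h := condExp_pastFiltration_eq hB hindep hunif n
      (h := fun b ω =>
        ((W.iterSubchannel g (fun k => B k ω) n).subchannel g b).symmetricCapacity)
      (fun b => stronglyMeasurable_pastFiltration hB (n := n)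
        (F := fun b' => ((W.iterSubchannel g b' n).subchannel g b).symmetricCapacity)
        fun b₁ b₂ h => by rw [W.iterSubchannel_congr g h])
      (fun b ω => hnorm _)
    refine EventuallyEq.trans (Eventually.of_forall fun ω => ?_) h.symm
    have hℓ : (ℓ : ℝ) ≠ 0 := NeZero.ne _
    rw [sum_symmetricCapacity_subchannel _ hX hg, inv_mul_cancel_left₀ hℓ]

end DMC

/-- If infinitely many steps increase a convergent sequence with values in `[0, 1]` by a fixed
amount whenever it is bounded away from `0` and `1`, then its limit is `0` or `1`. -/
lemma eq_zero_or_one_of_frequently_gain {x : ℕ → ℝ} {L : ℝ} (hx : ∀ n, x n ∈ Set.Icc (0 : ℝ) 1)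
    (hL : Tendsto x atTop (𝓝 L)) {p : ℕ → Prop} (hp : ∃ᶠ n in atTop, p n)
    (hgain : ∀ δ > 0, ∃ ε > 0, ∀ n, p n → x n ∈ Set.Icc δ (1 - δ) → x n + ε ≤ x (n + 1)) :
    L = 0 ∨ L = 1 := by
  have hmem : L ∈ Set.Icc (0 : ℝ) 1 := isClosed_Icc.mem_of_tendsto hL (Eventually.of_forall hx)
  by_contra! hne
  have h0 : 0 < L := lt_of_le_of_ne hmem.1 hne.1.symm
  have h1 : L < 1 := lt_of_le_of_ne hmem.2 hne.2
  obtain ⟨δ, hδ, hδ0, hδ1⟩ : ∃ δ > 0, δ < L ∧ L < 1 - δ :=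
    ⟨min L (1 - L) / 2, by have := lt_min h0 (sub_pos.2 h1); linarith,
      by linarith [min_le_left L (1 - L)], by linarith [min_le_right L (1 - L)]⟩
  obtain ⟨ε, hε, hstep⟩ := hgain δ hδ
  have hdiff : Tendsto (fun n => x (n + 1) - x n) atTop (𝓝 0) := by
    simpa using (hL.comp (tendsto_add_atTop_nat 1)).sub hL
  obtain ⟨n, hpn, hn, hlt⟩ := (hp.and_eventually
    ((hL.eventually (Icc_mem_nhds hδ0 hδ1)).and (hdiff.eventually (gt_mem_nhds hε)))).exists
  linarith [hstep n hpn hn]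

theorem mainTheorem1 {q : ℕ} [Fact q.Prime] {ℓ : ℕ}
    (G V L : Matrix (Fin ℓ) (Fin ℓ) (ZMod q)) (π : Equiv.Perm (Fin ℓ))
    (hG : IsUnit G.det)
    (hV : V.IsUpperTriangular)
    (hL : L.IsLowerTriangular)
    (hVLP : G = V * L * π.permMatrix (ZMod q))
    (hdiag : ¬ L.IsDiag)
    (W : DMC.{u} (ZMod q))
    {Ω : Type*} [MeasurableSpace Ω] (μ : Measure Ω) [IsProbabilityMeasure μ]
    (B : ℕ → Ω → Fin ℓ) (hB : ∀ n, Measurable (B n))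
    (hindep : iIndepFun B μ)
    (hunif : ∀ n b, μ (B n ⁻¹' {b}) = (ℓ : ENNReal)⁻¹) :
    Martingale
        (fun n ω =>
          (W.iterSubchannel (fun u => Matrix.vecMul u G) (fun k => B k ω) n).symmetricCapacity)
        (pastFiltration B hB) μ ∧
      ∃ Iinf : Ω → ℝ, Measurable Iinf ∧
        (∀ᵐ ω ∂μ, Tendsto
          (fun n =>
            (W.iterSubchannel (fun u => Matrix.vecMul u G) (fun k => B k ω) n).symmetricCapacity)
          atTop (𝓝 (Iinf ω))) ∧
        μ {ω | Iinf ω = 0 ∨ Iinf ω = 1} = 1 := by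
  obtain ⟨k, a, b, γ, hab, hγ, hka, ha, hb⟩ := exists_column_pair hG hV hL hVLP hdiag
  obtain ⟨f, f', hf⟩ := vecMul_column_pair ha hb
  have : NeZero ℓ := ⟨k.pos.ne'⟩
  have hX : 1 < Fintype.card (ZMod q) := by
    rw [ZMod.card]
    exact (Fact.out : q.Prime).one_lt
  have hg : Function.Bijective fun u : Fin ℓ → ZMod q => Matrix.vecMul u G :=
    Finite.injective_iff_bijective.1
      (Matrix.vecMul_injective_of_isUnit ((Matrix.isUnit_iff_isUnit_det G).2 hG))
  have hmart := W.martingale_symmetricCapacity hX hg hB hindep hunif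
  have hex := hmart.submartingale.exists_ae_tendsto_of_bdd (R := 1) fun n => by
    refine (eLpNorm_le_of_ae_bound (C := 1) (Eventually.of_forall fun ω => ?_)).trans (by simp)
    have h := (W.iterSubchannel (fun u => Matrix.vecMul u G)
      (fun k => B k ω) n).symmetricCapacity_mem_Icc hX
    rw [Real.norm_eq_abs, abs_of_nonneg h.1]
    exact h.2
  obtain ⟨Iinf, hmeas, hconv⟩ := measurable_limit_of_tendsto_metrizable_ae
    (fun n => (hmart.integrable n).aestronglyMeasurable.aemeasurable) hex
  refine ⟨hmart, Iinf, hmeas, hconv, ?_⟩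
  refine (mem_ae_iff_prob_eq_one ((hmeas (measurableSet_singleton 0)).union
    (hmeas (measurableSet_singleton 1)))).1 ?_
  filter_upwards [hconv, ae_frequently_eq hB hindep hunif k] with ω hω hfreq
  refine eq_zero_or_one_of_frequently_gain (fun n => DMC.symmetricCapacity_mem_Icc _ hX) hω hfreq
    fun δ hδ => ?_
  obtain ⟨ε, hε, hgain⟩ := DMC.exists_gain.{u} hg hab hka hγ (fun u => (hf u).1)
    (fun u => (hf u).2) hδ
  refine ⟨ε, hε, fun n hn hmem => ?_⟩
  rw [DMC.iterSubchannel, hn]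
  exact hgain _ hmem
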